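/- Let $R$ be an associative ring with identity, let $n\ge 2$ be an integer and let $d\in\{1,2,3,\dots\}\cup\{\infty\}$. For an integer $m\ge 0$, a left $R$-module $C$ is called finitely $m$-presented if there is an exact sequence $F_m\to\cdots\to F_1\to F_0\to C\to 0$ with all $F_i$ finitely generated projective. Let $\mathsf{FP}_m^{\le d}(R)$ be the class of finitely $m$-presented left $R$-modules of projective dimension at most $d$ (no condition on the projective dimension if $d=\infty$). The ring $R$ is left $(n,d)$-coherent if every module in $\mathsf{FP}_n^{\le d}(R)$ is finitely $(n+1)$-presented. A right $R$-module $M$ is $\mathsf{FP}_m^{\le d}$-flat if $\operatorname{Tor}^R_1(M,C)=0$ for all $C\in\mathsf{FP}_m^{\le d}(R)$, and a right $R$-module $N$ is $\mathsf{FP}_m^{\le d}$-cotorsion if $\operatorname{Ext}^1_{R^{\mathrm{op}}}(M,N)=0$ for every $\mathsf{FP}_m^{\le d}$-flat right $R$-module $M$. A pair $(\mathcal A,\mathcal B)$ of classes of right $R$-modules is a cotorsion pair if $\mathcal B=\{Y:\operatorname{Ext}^1_{R^{\mathrm{op}}}(X,Y)=0\ \text{for all } X\in\mathcal A\}$ and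 $\mathcal A=\{X:\operatorname{Ext}^1_{R^{\mathrm{op}}}(X,Y)=0\ \text{for all } Y\in\mathcal B\}$; it is hereditary if moreover $\operatorname{Ext}^i_{R^{\mathrm{op}}}(X,Y)=0$ for all $i\ge 1$, $X\in\mathcal A$, $Y\in\mathcal B$. The following statements are equivalent: 1. $R$ is left $(n,d)$-coherent. 2. $\operatorname{Tor}^R_{j+1}(M,C)=0$ for every integer $j\ge 0$, every $C\in\mathsf{FP}_n^{\le d}(R)$ and every $\mathsf{FP}_n^{\le d}$-flat right $R$-module $M$. 3. $\operatorname{Tor}^R_2(M,C)=0$ for every $C\in\mathsf{FP}_n^{\le d}(R)$ and every $\mathsf{FP}_n^{\le d}$-flat right $R$-module $M$. 4. Every $\mathsf{FP}_{n+1}^{\le d}$-flat right $R$-module is $\mathsf{FP}_n^{\le d}$-flat. 5. Every $\mathsf{FP}_n^{\le d}$-cotorsion right $R$-module is $\mathsf{FP}_{n+1}^{\le d}$-cotorsion. 6. The pair of the class of $\mathsf{FP}_n^{\le d}$-flat right $R$-modules and the class of $\mathsf{FP}_n^{\le d}$-cotorsion right $R$-modules is a hereditary cotorsion pair. -/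

import Mathlib

open CategoryTheory TensorProduct

universe u

/-! Left `R`-modules are the objects of `ModuleCat R`, right `R`-modules are the objects of
`ModuleCat Rᵐᵒᵖ`, the element `r` of `R` acting on the right on `m` being `MulOpposite.op r • m`. -/

noncomputable section

namespace NDCoh

variable {R : Type u} [Ring R]

/-- `M` is finitely `n`-presented: there is an exact sequence
`F n → F (n - 1) → ⋯ → F 1 → F 0 → M → 0` with all `F i`, `i ≤ n`, finitely generated projective.
(The values of `F` and `f` beyond this range are irrelevant.) -/
def FinitelyPresented (n : ℕ) (M : ModuleCat.{u} R) : Prop :=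
  ∃ (F : ℕ → ModuleCat.{u} R) (f : ∀ i, F (i + 1) →ₗ[R] F i) (p : F 0 →ₗ[R] M),
    (∀ i ≤ n, Module.Finite R (F i) ∧ Module.Projective R (F i)) ∧
    Function.Surjective p ∧
    (1 ≤ n → Function.Exact (f 0) p) ∧
    (∀ i, i + 2 ≤ n → Function.Exact (f (i + 1)) (f i))

/-- The class `FP_n^{≤ d}(R)` of finitely `n`-presented left `R`-modules of projective dimension
at most `d`; for `d = ⊤` there is no condition on the projective dimension. -/
def FPLe (n : ℕ) (d : ℕ∞) : ObjectProperty (ModuleCat.{u} R) := fun M =>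
  FinitelyPresented n M ∧ projectiveDimension M ≤ (d : WithBot ℕ∞)

variable (R) in
/-- `R` is left `(n, d)`-coherent. -/
def IsLeftCoherent (n : ℕ) (d : ℕ∞) : Prop :=
  ∀ M : ModuleCat.{u} R, FPLe n d M → FinitelyPresented (n + 1) M

section Tor

/-- The relations `m r ⊗ c = m ⊗ r c` in `M ⊗_ℤ C`. -/
def balancedRel (M : ModuleCat.{u} Rᵐᵒᵖ) (C : ModuleCat.{u} R) : AddSubgroup (M ⊗[ℤ] C) :=
  AddSubgroup.closure
    {x | ∃ (m : M) (r : R) (c : C), x = (MulOpposite.op r • m) ⊗ₜ[ℤ] c - m ⊗ₜ[ℤ] (r • c)}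

/-- The tensor product `M ⊗_R C` of a right and a left `R`-module, an abelian group. -/
abbrev BalancedTensor (M : ModuleCat.{u} Rᵐᵒᵖ) (C : ModuleCat.{u} R) : Type u :=
  (M ⊗[ℤ] C) ⧸ balancedRel M C

/-- The element `m ⊗ c` of `M ⊗_R C`. -/
def balancedTmul {M : ModuleCat.{u} Rᵐᵒᵖ} {C : ModuleCat.{u} R} (m : M) (c : C) :
    BalancedTensor M C :=
  QuotientAddGroup.mk (m ⊗ₜ[ℤ] c)

/-- Homomorphisms out of `M ⊗_R C` are determined by their values on the elements `m ⊗ c`. -/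
theorem balanced_hom_ext {M : ModuleCat.{u} Rᵐᵒᵖ} {C : ModuleCat.{u} R} {A : Type*}
    [AddCommGroup A] {f g : BalancedTensor M C →+ A}
    (h : ∀ (m : M) (c : C), f (balancedTmul m c) = g (balancedTmul m c)) : f = g := by
  refine QuotientAddGroup.addMonoidHom_ext _ (AddMonoidHom.ext fun x => ?_)
  induction x using TensorProduct.induction_on with
  | zero => simp only [map_zero]
  | tmul m c => exact h m c
  | add x y hx hy => simp only [map_add, hx, hy]

/-- The homomorphism `M ⊗_R C → M ⊗_R D`, `m ⊗ c ↦ m ⊗ f c`, induced by `f : C → D`. -/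
def balancedMap (M : ModuleCat.{u} Rᵐᵒᵖ) {C D : ModuleCat.{u} R} (f : C ⟶ D) :
    BalancedTensor M C →+ BalancedTensor M D :=
  QuotientAddGroup.map (balancedRel M C) (balancedRel M D)
    (LinearMap.lTensor M f.hom.toAddMonoidHom.toIntLinearMap).toAddMonoidHom (by
      refine (AddSubgroup.closure_le _).2 ?_
      rintro _ ⟨m, r, c, rfl⟩
      refine AddSubgroup.subset_closure ⟨m, r, f.hom c, ?_⟩
      rw [map_sub]
      exact congrArg (fun y => (MulOpposite.op r • m) ⊗ₜ[ℤ] f.hom c - m ⊗ₜ[ℤ] y)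
        (f.hom.map_smul r c))

/-- The functor `M ⊗_R -` from left `R`-modules to abelian groups. -/
def balancedTensorFunctor (M : ModuleCat.{u} Rᵐᵒᵖ) : ModuleCat.{u} R ⥤ AddCommGrpCat.{u} where
  obj C := AddCommGrpCat.of (BalancedTensor M C)
  map f := AddCommGrpCat.ofHom (balancedMap M f)
  map_id _ := AddCommGrpCat.hom_ext (balanced_hom_ext fun _ _ => rfl)
  map_comp _ _ := AddCommGrpCat.hom_ext (balanced_hom_ext fun _ _ => rfl)

instance (M : ModuleCat.{u} Rᵐᵒᵖ) : (balancedTensorFunctor M).Additive where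
  map_add {_ _ f g} := AddCommGrpCat.hom_ext (balanced_hom_ext fun m c =>
    congrArg QuotientAddGroup.mk (TensorProduct.tmul_add m (f.hom c) (g.hom c)))

/-- `Tor_i^R(M, C)`, the `i`-th left derived functor of `M ⊗_R -` at `C`. -/
def Tor (i : ℕ) (M : ModuleCat.{u} Rᵐᵒᵖ) (C : ModuleCat.{u} R) : AddCommGrpCat.{u} :=
  ((balancedTensorFunctor M).leftDerived i).obj C

end Tor

/-- The class of `FP_n^{≤ d}`-flat right `R`-modules. -/
def FPFlat (n : ℕ) (d : ℕ∞) : ObjectProperty (ModuleCat.{u} Rᵐᵒᵖ) := fun M =>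
  ∀ C : ModuleCat.{u} R, FPLe n d C → Limits.IsZero (Tor 1 M C)

/-- The class of `FP_n^{≤ d}`-cotorsion right `R`-modules. -/
def FPCot (n : ℕ) (d : ℕ∞) : ObjectProperty (ModuleCat.{u} Rᵐᵒᵖ) := fun M =>
  ∀ F : ModuleCat.{u} Rᵐᵒᵖ, FPFlat n d F → Subsingleton (Abelian.Ext F M 1)

/-- `(A, B)` is a cotorsion pair: `B = A^{⊥₁}` and `A = ^{⊥₁}B`. -/
structure IsCotorsionPair {S : Type u} [Ring S] (A B : ObjectProperty (ModuleCat.{u} S)) :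
    Prop where
  right_iff : ∀ Y, B Y ↔ ∀ X, A X → Subsingleton (Abelian.Ext X Y 1)
  left_iff : ∀ X, A X ↔ ∀ Y, B Y → Subsingleton (Abelian.Ext X Y 1)

/-- A cotorsion pair `(A, B)` is hereditary if `Ext^i(X, Y) = 0` for all `i ≥ 1`, `X` in `A` and
`Y` in `B`. -/
structure IsHereditaryCotorsionPair {S : Type u} [Ring S]
    (A B : ObjectProperty (ModuleCat.{u} S)) : Prop extends IsCotorsionPair A B where
  ext_vanish : ∀ X Y, A X → B Y → ∀ i : ℕ, 1 ≤ i → Subsingleton (Abelian.Ext X Y i)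

end NDCoh

end

/-! Write X⁺ for the ℚ/ℤ-character module. Tensor-hom adjunction makes Tor_j(M, C) vanish exactly
when Ext^j(M, C⁺) does, for j ≥ 1 (`isZero_tor_iff`), so the whole argument runs with Ext of right
modules and dimension shifting in either variable.

The test modules are the powers R^I. If C is finitely (m+1)-presented, then Tor_i(R^I, C) = 0 for 1
≤ i ≤ m, and C is finitely (m+2)-presented as soon as Tor_{m+1}(R^I, C) = 0 for all I
(`ext_pow_of_finitelyPresented`, `finitelyPresented_of_ext_pow`). Hence the syzygy Ω^{n-2} R^I is
always FP_n-flat, and Ω^{n-1} R^I is FP_{n+1}-flat. Both Tor_2 of the former and Tor_1 of the latter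
compute Tor_n(R^I, C), the obstruction to coherence. This gives 3 ⇒ 1 and 4 ⇒ 1. For 1 ⇒ 2,
coherence keeps the kernel of a finitely generated projective cover inside the class, so one shifts
down to Tor_1.

The modules C⁺ are cotorsion and already detect flatness, which gives the cotorsion pair and 5 ⇒ 4.
Condition 3 closes the flat class under syzygies, hence heredity; conversely, Ext² into C⁺ recovers
3. -/

noncomputable section

namespace NDCoh

/-! ### Injectivity and cogeneration by ℚ/ℤ. -/

section Characters

/-- A character of `A` vanishing on the kernel of `f : A → B` factors through `f`. -/
theorem exists_character_extension {A B : Type*} [AddCommGroup A] [AddCommGroup B] (f : A →+ B)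
    (h : A →+ AddCircle (1 : ℚ)) (hh : ∀ a, f a = 0 → h a = 0) :
    ∃ ψ : B →+ AddCircle (1 : ℚ), ∀ a, ψ (f a) = h a := by
  let F : A ⧸ f.ker →+ B := QuotientAddGroup.kerLift f
  let H : CharacterModule (A ⧸ f.ker) := QuotientAddGroup.lift f.ker h hh
  obtain ⟨ψ, hψ⟩ := CharacterModule.dual_surjective_of_injective (R := ℤ) F.toIntLinearMap
    (QuotientAddGroup.kerLift_injective f) H
  exact ⟨ψ, fun a => DFunLike.congr_fun hψ (QuotientAddGroup.mk a)⟩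

/-- Characters separate elements from subgroups. -/
theorem exists_character_of_notMem {A : Type*} [AddCommGroup A] (S : AddSubgroup A) {a : A}
    (ha : a ∉ S) :
    ∃ χ : A →+ AddCircle (1 : ℚ), (∀ s ∈ S, χ s = 0) ∧ χ a ≠ 0 := by
  have h0 : (QuotientAddGroup.mk a : A ⧸ S) ≠ 0 := fun h =>
    ha ((QuotientAddGroup.eq_zero_iff a).1 h)
  obtain ⟨c, hc⟩ := CharacterModule.exists_character_apply_ne_zero_of_ne_zero h0
  let c' : (A ⧸ S) →+ AddCircle (1 : ℚ) := c
  refine ⟨c'.comp (QuotientAddGroup.mk' S), fun s hs => ?_, hc⟩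
  have : (QuotientAddGroup.mk' S) s = 0 := (QuotientAddGroup.eq_zero_iff s).2 hs
  rw [AddMonoidHom.comp_apply, this, map_zero]

/-- A sequence of abelian groups is exact if and only if its sequence of characters is. -/
theorem exact_iff_character_exact {A B C : Type*} [AddCommGroup A] [AddCommGroup B]
    [AddCommGroup C] (f : A →+ B) (g : B →+ C) :
    (∀ b, g b = 0 → ∃ a, f a = b) ↔
      ∀ χ : B →+ AddCircle (1 : ℚ), (∀ a, χ (f a) = 0) →
        ∃ ψ : C →+ AddCircle (1 : ℚ), ∀ b, ψ (g b) = χ b := by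
  constructor
  · intro h χ hχ
    refine exists_character_extension g χ fun b hb => ?_
    obtain ⟨a, rfl⟩ := h b hb
    exact hχ a
  · intro h b hb
    by_contra hcon
    obtain ⟨χ, hχ, hne⟩ := exists_character_of_notMem f.range (a := b) hcon
    obtain ⟨ψ, hψ⟩ := h χ fun a => hχ _ ⟨a, rfl⟩
    exact hne (by rw [← hψ, hb, map_zero])

end Characters

/-! ### Character modules and tensor-hom adjunction. -/

section CharacterModule

/-- The characters of a left `R`-module form a right `R`-module. -/
instance characterModuleOp {S : Type*} [Ring S] {A : Type*} [AddCommGroup A] [Module S A] :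
    Module Sᵐᵒᵖ (A →+ AddCircle (1 : ℚ)) where
  smul r φ := AddMonoidHom.comp φ (DistribSMul.toAddMonoidHom A r.unop)
  one_smul φ := AddMonoidHom.ext fun a => congrArg φ (one_smul S a)
  mul_smul r s φ := AddMonoidHom.ext fun a => congrArg φ (mul_smul s.unop r.unop a)
  smul_zero _ := rfl
  smul_add _ _ _ := rfl
  add_smul r s φ := AddMonoidHom.ext fun a =>
    (congrArg φ (add_smul r.unop s.unop a)).trans (map_add φ _ _)
  zero_smul φ := AddMonoidHom.ext fun a =>
    (congrArg φ (zero_smul S a)).trans (map_zero φ)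

variable {R : Type u} [Ring R]

/-- The character module of a left `R`-module, a right `R`-module. -/
def charObj (C : ModuleCat.{u} R) : ModuleCat.{u} Rᵐᵒᵖ := ModuleCat.of Rᵐᵒᵖ (C →+ AddCircle (1 : ℚ))

/-- The map of character modules induced by a linear map. -/
def charMap {C D : ModuleCat.{u} R} (f : C ⟶ D) : charObj D ⟶ charObj C :=
  ModuleCat.ofHom
    { toFun := fun φ => (AddMonoidHom.comp φ f.hom.toAddMonoidHom : (C →+ AddCircle (1 : ℚ)))
      map_add' := fun _ _ => rfl
      map_smul' := fun r φ => AddMonoidHom.ext fun c =>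
        congrArg φ (f.hom.map_smul r.unop c).symm }

/-- The character underlying an element of `charObj C`. -/
def charVal {C : ModuleCat.{u} R} : charObj C →+ (C →+ AddCircle (1 : ℚ)) :=
  AddMonoidHom.id (C →+ AddCircle (1 : ℚ))

theorem charVal_injective {C : ModuleCat.{u} R} :
    Function.Injective (charVal : charObj C →+ (C →+ AddCircle (1 : ℚ))) := fun _ _ h => h

theorem charVal_smul {C : ModuleCat.{u} R} (r : Rᵐᵒᵖ) (φ : charObj C) (c : C) :
    charVal (r • φ) c = charVal φ (r.unop • c) := rfl

theorem charMap_comp {C D E : ModuleCat.{u} R} (f : C ⟶ D) (g : D ⟶ E) :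
    charMap (f ≫ g) = charMap g ≫ charMap f := rfl

theorem charMap_zero (C D : ModuleCat.{u} R) : charMap (0 : C ⟶ D) = 0 := by
  ext φ
  exact charVal_injective (AddMonoidHom.ext fun c => map_zero (charVal φ))

/-- The character functor turns exact sequences into exact sequences. -/
theorem charMap_exact {A B C : ModuleCat.{u} R} (f : A ⟶ B) (g : B ⟶ C)
    (h : ∀ b, g b = 0 → ∃ a, f a = b) (φ : charObj B) (hφ : (charMap f).hom φ = 0) :
    ∃ ψ, (charMap g).hom ψ = φ := by
  obtain ⟨ψ, hψ⟩ := (exact_iff_character_exact f.hom.toAddMonoidHom g.hom.toAddMonoidHom).1 h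
    (charVal φ) fun a => DFunLike.congr_fun (congrArg charVal hφ) a
  exact ⟨ψ, charVal_injective (AddMonoidHom.ext hψ)⟩

/-- The character module of a projective module is injective. -/
theorem injective_charObj (P : ModuleCat.{u} R) [Module.Projective R P] :
    Injective (charObj P) where
  factors {A B} φ f hf := by
    -- The characters of a right module are a module over `Rᵐᵒᵖᵐᵒᵖ`, pulled back here to `R`.
    let mA : Module R (A →+ AddCircle (1 : ℚ)) := Module.compHom _ (RingEquiv.opOp R).toRingHom
    let mB : Module R (B →+ AddCircle (1 : ℚ)) := Module.compHom _ (RingEquiv.opOp R).toRingHom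
    let res : (B →+ AddCircle (1 : ℚ)) →ₗ[R] (A →+ AddCircle (1 : ℚ)) :=
      { toFun := fun χ => AddMonoidHom.comp χ f.hom.toAddMonoidHom
        map_add' := fun _ _ => rfl
        map_smul' := fun r χ => AddMonoidHom.ext fun a =>
          congrArg χ (f.hom.map_smul (MulOpposite.op r) a).symm }
    have hres : Function.Surjective res := fun χ => by
      obtain ⟨ψ, hψ⟩ := exists_character_extension f.hom.toAddMonoidHom χ fun a ha => by
        have : a = 0 := (ModuleCat.mono_iff_injective f).1 hf (ha.trans (map_zero f.hom).symm)
        rw [this, map_zero]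
      exact ⟨ψ, AddMonoidHom.ext hψ⟩
    -- Swapping arguments turns A → P⁺ into P → A⁺; projectivity lifts it along the surjection B⁺ →
    -- A⁺, and swapping back gives the extension B → P⁺.
    let sw : P →ₗ[R] (A →+ AddCircle (1 : ℚ)) :=
      { toFun := fun p =>
          ({ toFun := fun a => charVal (φ.hom a) p
             map_zero' := by simp
             map_add' := fun a b => by simp } : (A →+ AddCircle (1 : ℚ)))
        map_add' := fun p q => AddMonoidHom.ext fun a => map_add (charVal (φ.hom a)) p q
        map_smul' := fun r p => AddMonoidHom.ext fun a => by
          change charVal (φ.hom a) (r • p) = charVal (φ.hom (MulOpposite.op r • a)) p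
          rw [LinearMap.map_smul φ.hom]
          rfl }
    obtain ⟨l, hl⟩ := Module.projective_lifting_property res sw hres
    refine ⟨ModuleCat.ofHom
      { toFun := fun b =>
          ({ toFun := fun p => l p b
             map_zero' := by rw [map_zero]; rfl
             map_add' := fun p q => by rw [map_add]; rfl } : (P →+ AddCircle (1 : ℚ)))
        map_add' := fun b c => charVal_injective (AddMonoidHom.ext fun p => map_add (l p) b c)
        map_smul' := fun r b => charVal_injective (AddMonoidHom.ext fun p => by
          change l p (r • b) = l (r.unop • p) b
          rw [LinearMap.map_smul l]
          rfl) }, ?_⟩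
    ext a
    refine charVal_injective (AddMonoidHom.ext fun p => ?_)
    exact DFunLike.congr_fun (LinearMap.congr_fun hl p) a

/-- Homomorphisms `M → C⁺` from characters of `M ⊗_R C`. -/
def homOfCharacter {M : ModuleCat.{u} Rᵐᵒᵖ} {C : ModuleCat.{u} R}
    (χ : BalancedTensor M C →+ AddCircle (1 : ℚ)) : M ⟶ charObj C :=
  ModuleCat.ofHom
    { toFun := fun m =>
        ({ toFun := fun c => χ (balancedTmul m c)
           map_zero' := (congrArg (fun t => χ (QuotientAddGroup.mk t))
             (TensorProduct.tmul_zero C m)).trans (map_zero χ)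
           map_add' := fun c d => (congrArg (fun t => χ (QuotientAddGroup.mk t))
             (TensorProduct.tmul_add m c d)).trans
               (map_add χ (balancedTmul m c) (balancedTmul m d)) } : (C →+ AddCircle (1 : ℚ)))
      map_add' := fun m m' => charVal_injective (AddMonoidHom.ext fun c =>
        (congrArg (fun t => χ (QuotientAddGroup.mk t))
          (TensorProduct.add_tmul m m' c)).trans
            (map_add χ (balancedTmul m c) (balancedTmul m' c)))
      map_smul' := fun r m => charVal_injective (AddMonoidHom.ext fun c => congrArg χ (by
        refine (QuotientAddGroup.eq_iff_sub_mem).2 ?_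
        exact AddSubgroup.subset_closure ⟨m, r.unop, c, rfl⟩)) }

theorem homOfCharacter_apply {M : ModuleCat.{u} Rᵐᵒᵖ} {C : ModuleCat.{u} R}
    (χ : BalancedTensor M C →+ AddCircle (1 : ℚ)) (m : M) (c : C) :
    charVal ((homOfCharacter χ).hom m) c = χ (balancedTmul m c) := rfl

theorem homOfCharacter_injective {M : ModuleCat.{u} Rᵐᵒᵖ} {C : ModuleCat.{u} R} :
    Function.Injective
      (homOfCharacter : (BalancedTensor M C →+ AddCircle (1 : ℚ)) → (M ⟶ charObj C)) := by
  intro χ χ' h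
  refine balanced_hom_ext fun m c => ?_
  rw [← homOfCharacter_apply, h, homOfCharacter_apply]

/-- A map into C⁺ uncurries to a character of M ⊗_ℤ C, and its `Rᵐᵒᵖ`-linearity is what makes that
character kill the balancing relations. -/
theorem homOfCharacter_surjective {M : ModuleCat.{u} Rᵐᵒᵖ} {C : ModuleCat.{u} R} :
    Function.Surjective
      (homOfCharacter : (BalancedTensor M C →+ AddCircle (1 : ℚ)) → (M ⟶ charObj C)) := by
  intro f
  let g : (M ⊗[ℤ] C) →+ AddCircle (1 : ℚ) :=
    TensorProduct.liftAddHom (charVal.comp f.hom.toAddMonoidHom) fun r m c => by simp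
  refine ⟨QuotientAddGroup.lift (balancedRel M C) g ?_, ?_⟩
  · refine (AddSubgroup.closure_le _).2 ?_
    rintro _ ⟨m, r, c, rfl⟩
    change g (_ - _) = 0
    rw [map_sub, sub_eq_zero]
    change charVal (f.hom (MulOpposite.op r • m)) c = charVal (f.hom m) (r • c)
    rw [map_smul]
    rfl
  · ext m
    exact charVal_injective (AddMonoidHom.ext fun c => rfl)

theorem homOfCharacter_comp {M : ModuleCat.{u} Rᵐᵒᵖ} {C D : ModuleCat.{u} R} (f : C ⟶ D)
    (χ : BalancedTensor M D →+ AddCircle (1 : ℚ)) :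
    homOfCharacter (χ.comp (balancedMap M f)) = homOfCharacter χ ≫ charMap f := rfl

/-- Exactness of `M ⊗_R A → M ⊗_R B → M ⊗_R C` in terms of homomorphisms into character
modules. -/
theorem balanced_exact_iff (M : ModuleCat.{u} Rᵐᵒᵖ) {A B C : ModuleCat.{u} R} (f : A ⟶ B)
    (g : B ⟶ C) :
    (∀ b, balancedMap M g b = 0 → ∃ a, balancedMap M f a = b) ↔
      ∀ χ : M ⟶ charObj B, χ ≫ charMap f = 0 → ∃ ψ : M ⟶ charObj C, ψ ≫ charMap g = χ := by
  rw [exact_iff_character_exact]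
  have hz : homOfCharacter (0 : BalancedTensor M A →+ AddCircle (1 : ℚ)) = 0 := rfl
  constructor
  · intro h χ hχ
    obtain ⟨χ, rfl⟩ := homOfCharacter_surjective χ
    rw [← homOfCharacter_comp, ← hz] at hχ
    obtain ⟨ψ, hψ⟩ := h χ fun a => DFunLike.congr_fun (homOfCharacter_injective hχ) a
    refine ⟨homOfCharacter ψ, ?_⟩
    rw [← homOfCharacter_comp]
    exact congrArg _ (AddMonoidHom.ext hψ)
  · intro h χ hχ
    obtain ⟨ψ, hψ⟩ := h (homOfCharacter χ) (by
      rw [← homOfCharacter_comp, ← hz]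
      exact congrArg _ (AddMonoidHom.ext hχ))
    obtain ⟨ψ, rfl⟩ := homOfCharacter_surjective ψ
    rw [← homOfCharacter_comp] at hψ
    exact ⟨ψ, fun b => DFunLike.congr_fun (homOfCharacter_injective hψ) b⟩

end CharacterModule

/-! ### Dual resolutions and the comparison of Tor with Ext. -/

section Resolution

variable {R : Type u} [Ring R]

/-- The cochain complex of character modules of a chain complex. -/
def charComplex (K : ChainComplex (ModuleCat.{u} R) ℕ) :
    CochainComplex (ModuleCat.{u} Rᵐᵒᵖ) ℕ where
  X n := charObj (K.X n)
  d i j := charMap (K.d j i)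
  shape i j h := by rw [K.shape j i h, charMap_zero]
  d_comp_d' i j k _ _ := by rw [← charMap_comp, K.d_comp_d, charMap_zero]

theorem charMap_exact_shortComplex {A B C : ModuleCat.{u} R} (f : A ⟶ B) (g : B ⟶ C)
    (w : f ≫ g = 0) (w' : charMap g ≫ charMap f = 0) (h : (ShortComplex.mk f g w).Exact) :
    (ShortComplex.mk (charMap g) (charMap f) w').Exact :=
  (ShortComplex.moduleCat_exact_iff _).2
    (charMap_exact f g ((ShortComplex.moduleCat_exact_iff _).1 h))

instance mono_charMap {C D : ModuleCat.{u} R} (f : C ⟶ D) [Epi f] : Mono (charMap f) := by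
  rw [ModuleCat.mono_iff_injective]
  intro φ ψ h
  refine charVal_injective (AddMonoidHom.ext fun d => ?_)
  obtain ⟨c, rfl⟩ := (ModuleCat.epi_iff_surjective f).1 inferInstance d
  exact DFunLike.congr_fun (congrArg charVal h) c

/-- The character modules of a projective resolution of `C` form an injective resolution of
the character module of `C`. -/
def charResolution {C : ModuleCat.{u} R} (P : ProjectiveResolution C) :
    InjectiveResolution (charObj C) :=
  let π : P.complex.X 0 ⟶ C := P.π.f 0
  have hπ : P.complex.d 1 0 ≫ π = 0 := P.complex_d_comp_π_f_zero
  have hπ' : charMap π ≫ charMap (P.complex.d 1 0) = 0 := by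
    rw [← charMap_comp, hπ, charMap_zero]
  have : Epi π := inferInstanceAs (Epi (P.π.f 0))
  { cocomplex := charComplex P.complex
    injective := fun n => by
      have := P.projective n
      have : Module.Projective R (P.complex.X n) := (IsProjective.iff_projective _).2 this
      exact injective_charObj _
    ι := (CochainComplex.fromSingle₀Equiv _ _).symm ⟨charMap π, hπ'⟩
    quasiIso := ⟨fun n => by
      cases n with
      | zero =>
        -- In degree 0 the claim is exactness of 0 → C⁺ → P₀⁺ → P₁⁺, dual to that of P₁ → P₀ → C →
        -- 0.
        rw [CochainComplex.quasiIsoAt₀_iff, ShortComplex.quasiIso_iff_of_zeros]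
        · refine (ShortComplex.exact_and_mono_f_iff_of_iso ?_).2
            ⟨charMap_exact_shortComplex _ π hπ hπ' P.exact₀, mono_charMap π⟩
          exact ShortComplex.isoMk (Iso.refl _) (Iso.refl _) (Iso.refl _)
            ((Category.id_comp _).trans (Category.comp_id _).symm)
            ((Category.id_comp _).trans (Category.comp_id _).symm)
        · rfl
        · rfl
        · exact (charComplex P.complex).shape 0 0 (by simp)
      | succ n =>
        rw [quasiIsoAt_iff_exactAt]
        · rw [HomologicalComplex.exactAt_iff' _ n (n + 1) (n + 2) (by simp) (by simp)]
          exact charMap_exact_shortComplex _ _ _ _ (P.exact_succ n)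
        · apply CochainComplex.exactAt_succ_single_obj⟩ }

/-- `Tor` vanishes if and only if `Ext` into the character module does. -/
theorem isZero_tor_iff (j : ℕ) (M : ModuleCat.{u} Rᵐᵒᵖ) (C : ModuleCat.{u} R) :
    Limits.IsZero (Tor (j + 1) M C) ↔ Subsingleton (Abelian.Ext M (charObj C) (j + 1)) := by
  let P := projectiveResolution C
  let Q := charResolution P
  have h1 : Limits.IsZero (Tor (j + 1) M C) ↔
      (((balancedTensorFunctor M).mapHomologicalComplex _).obj P.complex).ExactAt (j + 1) := by
    rw [HomologicalComplex.exactAt_iff_isZero_homology]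
    exact (P.isoLeftDerivedObj (balancedTensorFunctor M) (j + 1)).isZero_iff
  rw [h1, HomologicalComplex.exactAt_iff' _ (j + 2) (j + 1) j (by simp) (by simp),
    ShortComplex.ab_exact_iff]
  -- Exactness of M ⊗ P in degree j + 1 now reads: every cocycle M → P_{j+1}⁺ is a coboundary. In
  -- the injective resolution P⁺ this is the vanishing of every Ext class.
  refine (balanced_exact_iff M (P.complex.d (j + 2) (j + 1)) (P.complex.d (j + 1) j)).trans ?_
  constructor
  · intro h
    refine subsingleton_of_forall_eq 0 fun x => ?_
    obtain ⟨f, hf, rfl⟩ := Q.extMk_surjective x (j + 2) rfl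
    exact (Q.extMk_eq_zero_iff f (j + 2) rfl hf j rfl).2 (h f hf)
  · intro h χ hχ
    exact (Q.extMk_eq_zero_iff χ (j + 2) rfl hχ j rfl).1 (Subsingleton.elim _ _)

end Resolution

/-! ### Dimension shifting and syzygies. -/

section DimensionShifting

variable {S : Type u} [Ring S]

/-- Dimension shifting for `Ext` in the first argument. -/
theorem ext_shift_left {T : ShortComplex (ModuleCat.{u} S)} (hT : T.ShortExact)
    [Projective T.X₂] (Y : ModuleCat.{u} S) (i : ℕ) :
    Subsingleton (Abelian.Ext T.X₃ Y (i + 2)) ↔ Subsingleton (Abelian.Ext T.X₁ Y (i + 1)) := by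
  constructor
  · intro h
    refine subsingleton_of_forall_eq 0 fun x => ?_
    obtain ⟨y, rfl⟩ := Abelian.Ext.contravariant_sequence_exact₁ hT Y x (n₁ := i + 2) (by lia)
      (Subsingleton.elim _ _)
    rw [Abelian.Ext.eq_zero_of_projective y, Abelian.Ext.comp_zero]
  · intro h
    refine subsingleton_of_forall_eq 0 fun x => ?_
    obtain ⟨y, rfl⟩ := Abelian.Ext.contravariant_sequence_exact₃ hT Y x
      (Abelian.Ext.eq_zero_of_projective _) (n₀ := i + 1) (by lia)
    rw [Subsingleton.elim y 0, Abelian.Ext.comp_zero]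

/-- Dimension shifting for `Ext` in the second argument. -/
theorem ext_shift_right {T : ShortComplex (ModuleCat.{u} S)} (hT : T.ShortExact)
    [Injective T.X₂] (X : ModuleCat.{u} S) (i : ℕ) :
    Subsingleton (Abelian.Ext X T.X₁ (i + 2)) ↔ Subsingleton (Abelian.Ext X T.X₃ (i + 1)) := by
  constructor
  · intro h
    refine subsingleton_of_forall_eq 0 fun x => ?_
    obtain ⟨y, rfl⟩ := Abelian.Ext.covariant_sequence_exact₃ X hT x (n₁ := i + 2) rfl
      (Subsingleton.elim _ _)
    rw [Abelian.Ext.eq_zero_of_injective y, Abelian.Ext.zero_comp]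
  · intro h
    refine subsingleton_of_forall_eq 0 fun x => ?_
    obtain ⟨y, rfl⟩ := Abelian.Ext.covariant_sequence_exact₁ X hT x
      (Abelian.Ext.eq_zero_of_injective _) (n₀ := i + 1) rfl
    rw [Subsingleton.elim y 0, Abelian.Ext.zero_comp]

/-- Vanishing of `Ext¹` as a lifting property. -/
theorem ext_one_iff_lift {T : ShortComplex (ModuleCat.{u} S)} (hT : T.ShortExact)
    [Injective T.X₂] (X : ModuleCat.{u} S) :
    Subsingleton (Abelian.Ext X T.X₁ 1) ↔ ∀ φ : X ⟶ T.X₃, ∃ ψ : X ⟶ T.X₂, ψ ≫ T.g = φ := by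
  constructor
  · intro h φ
    obtain ⟨y, hy⟩ := Abelian.Ext.covariant_sequence_exact₃ X hT (Abelian.Ext.mk₀ φ) (n₁ := 1) rfl
      (Subsingleton.elim _ _)
    obtain ⟨ψ, rfl⟩ := Abelian.Ext.homEquiv₀.symm.surjective y
    refine ⟨ψ, Abelian.Ext.homEquiv₀.symm.injective ?_⟩
    exact (Abelian.Ext.mk₀_comp_mk₀ ψ T.g).symm.trans hy
  · intro h
    refine subsingleton_of_forall_eq 0 fun x => ?_
    obtain ⟨y, rfl⟩ := Abelian.Ext.covariant_sequence_exact₁ X hT x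
      (Abelian.Ext.eq_zero_of_injective _) (n₀ := 0) rfl
    obtain ⟨φ, rfl⟩ := Abelian.Ext.homEquiv₀.symm.surjective y
    obtain ⟨ψ, rfl⟩ := h φ
    change (Abelian.Ext.mk₀ (ψ ≫ T.g)).comp hT.extClass _ = 0
    rw [← Abelian.Ext.mk₀_comp_mk₀_assoc, hT.comp_extClass, Abelian.Ext.comp_zero]

instance (M : ModuleCat.{u} S) : Projective M.projectiveShortComplex.X₂ :=
  (IsProjective.iff_projective _).1 inferInstance

/-- The `k`-th syzygy of a module. -/
def syzygy (M : ModuleCat.{u} S) : ℕ → ModuleCat.{u} S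
  | 0 => M
  | k + 1 => (syzygy M k).projectiveShortComplex.X₁

theorem ext_syzygy (M Y : ModuleCat.{u} S) (k i : ℕ) :
    Subsingleton (Abelian.Ext (syzygy M k) Y (i + 1)) ↔
      Subsingleton (Abelian.Ext M Y (i + k + 1)) := by
  induction k generalizing i with
  | zero => rfl
  | succ k ih =>
    rw [syzygy, ← ext_shift_left (ModuleCat.shortExact_projectiveShortComplex _) Y i]
    refine (ih (i + 1)).trans ?_
    rw [show i + 1 + k + 1 = i + (k + 1) + 1 by lia]

end DimensionShifting

/-! ### Shifting along the dual of a projective cover. -/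

section CharacterSequences

variable {R : Type u} [Ring R]

/-- The sequence of character modules of a short complex. -/
def charShortComplex (T : ShortComplex (ModuleCat.{u} R)) :
    ShortComplex (ModuleCat.{u} Rᵐᵒᵖ) :=
  ShortComplex.mk (charMap T.g) (charMap T.f) (by rw [← charMap_comp, T.zero, charMap_zero])

theorem charShortComplex_shortExact {T : ShortComplex (ModuleCat.{u} R)} (hT : T.ShortExact) :
    (charShortComplex T).ShortExact where
  exact := charMap_exact_shortComplex T.f T.g T.zero _ hT.exact
  mono_f := by
    have := hT.epi_g
    exact mono_charMap T.g
  epi_g := by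
    rw [ModuleCat.epi_iff_surjective]
    intro φ
    obtain ⟨ψ, hψ⟩ := exists_character_extension T.f.hom.toAddMonoidHom (charVal φ) fun a ha => by
      have : a = 0 := hT.moduleCat_injective_f (ha.trans (map_zero T.f.hom).symm)
      rw [this, map_zero]
    exact ⟨ψ, charVal_injective (AddMonoidHom.ext hψ)⟩

/-- With K the kernel of `p`, the dual sequence 0 → C⁺ → P⁺ → K⁺ → 0 is exact with injective middle
term. -/
theorem ext_char_shift {P C : ModuleCat.{u} R} [Module.Projective R P] (p : P →ₗ[R] C)
    (hp : Function.Surjective p) (M : ModuleCat.{u} Rᵐᵒᵖ) (i : ℕ) :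
    Subsingleton (Abelian.Ext M (charObj C) (i + 2)) ↔
      Subsingleton (Abelian.Ext M (charObj (ModuleCat.of R (LinearMap.ker p))) (i + 1)) := by
  have : Injective (charShortComplex p.shortComplexKer).X₂ := injective_charObj P
  exact ext_shift_right (charShortComplex_shortExact (LinearMap.shortExact_shortComplexKer hp)) M i

/-- The lifting condition is the dual form of injectivity of M ⊗ K → M ⊗ P, where K is the kernel of
`p`. -/
theorem ext_char_one_iff {P C : ModuleCat.{u} R} [Module.Projective R P] (p : P →ₗ[R] C)
    (hp : Function.Surjective p) (M : ModuleCat.{u} Rᵐᵒᵖ) :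
    Subsingleton (Abelian.Ext M (charObj C) 1) ↔
      ∀ φ : M ⟶ charObj (ModuleCat.of R (LinearMap.ker p)), ∃ ψ : M ⟶ charObj P,
        ∀ (m : M) (x : LinearMap.ker p), charVal (ψ.hom m) x = charVal (φ.hom m) x := by
  have : Injective (charShortComplex p.shortComplexKer).X₂ := injective_charObj P
  have hS := charShortComplex_shortExact (LinearMap.shortExact_shortComplexKer hp)
  refine (ext_one_iff_lift hS M).trans ?_
  refine forall_congr' fun φ => exists_congr fun ψ => ?_
  constructor
  · rintro rfl m x
    rfl
  · intro h
    ext m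
    exact charVal_injective (AddMonoidHom.ext fun x => h m x)

end CharacterSequences

/-! ### Finite presentations as a recursion on kernels. -/

section Presentations

variable {R : Type u} [Ring R]

theorem finitelyPresented_zero_iff (C : ModuleCat.{u} R) :
    FinitelyPresented 0 C ↔ Module.Finite R C := by
  constructor
  · rintro ⟨F, f, p, hF, hp, -, -⟩
    have := (hF 0 le_rfl).1
    exact Module.Finite.of_surjective p hp
  · intro h
    obtain ⟨k, q, hq⟩ := Module.Finite.exists_fin' R C
    refine ⟨fun _ => ModuleCat.of R (Fin k → R), fun _ => 0, q, fun i _ => ⟨?_, ?_⟩, hq, by lia,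
      by lia⟩
    · change Module.Finite R (Fin k → R); infer_instance
    · change Module.Projective R (Fin k → R); infer_instance

/-- Cutting the resolution at F₀ leaves a resolution of the kernel; this is the recursion behind the
inductions on presentation length. -/
theorem finitelyPresented_succ_iff (n : ℕ) (C : ModuleCat.{u} R) :
    FinitelyPresented (n + 1) C ↔
      ∃ (P : ModuleCat.{u} R) (p : P →ₗ[R] C), Module.Finite R P ∧ Module.Projective R P ∧
        Function.Surjective p ∧ FinitelyPresented n (ModuleCat.of R (LinearMap.ker p)) := by
  constructor
  · rintro ⟨F, f, p, hF, hp, h0, h⟩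
    have h0 := h0 (by lia)
    refine ⟨F 0, p, (hF 0 (by lia)).1, (hF 0 (by lia)).2, hp, fun i => F (i + 1),
      fun i => f (i + 1), (f 0).codRestrict _ fun x => h0.apply_apply_eq_zero x,
      fun i hi => hF (i + 1) (by lia), fun x => ?_, fun hn x => ?_, fun i hi => h (i + 1) (by lia)⟩
    · obtain ⟨y, hy⟩ := (h0 x.1).1 x.2
      exact ⟨y, Subtype.ext hy⟩
    · exact (Subtype.ext_iff).trans (h 0 (by lia) x)
  · rintro ⟨P, p, hP, hP', hp, F, f, q, hF, hq, h0, h⟩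
    refine ⟨fun i => Nat.casesOn i P F,
      fun i => Nat.casesOn i ((LinearMap.ker p).subtype ∘ₗ q) f, p, fun i hi => ?_, hp, fun _ x => ?_,
      fun i hi => ?_⟩
    · cases i with
      | zero => exact ⟨hP, hP'⟩
      | succ i => exact hF i (by lia)
    · constructor
      · intro hx
        obtain ⟨y, hy⟩ := hq ⟨x, hx⟩
        exact ⟨y, congrArg Subtype.val hy⟩
      · rintro ⟨y, rfl⟩
        exact (q y).2
    · cases i with
      | zero => exact fun x => (Subtype.ext_iff.symm.trans (h0 (by lia) x))
      | succ i => exact h i (by lia)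

theorem FinitelyPresented.of_le {m n : ℕ} (h : m ≤ n) {C : ModuleCat.{u} R}
    (hC : FinitelyPresented n C) : FinitelyPresented m C := by
  obtain ⟨F, f, p, hF, hp, h0, h1⟩ := hC
  exact ⟨F, f, p, fun i hi => hF i (by lia), hp, fun _ => h0 (by lia), fun i hi => h1 i (by lia)⟩

/-! ### Powers of the ring as test modules for finite presentation. -/

/-- The right `R`-module `R^I`. -/
abbrev powObj (R : Type u) [Ring R] (I : Type u) : ModuleCat.{u} Rᵐᵒᵖ :=
  ModuleCat.of Rᵐᵒᵖ (I → R)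

/-- The decomposition of a family of row vectors into its columns. -/
theorem eq_sum_columns {I : Type*} {k : ℕ} (v : I → Fin k → R) :
    v = ∑ j, fun i => v i j • (Pi.single j 1 : Fin k → R) := by
  ext i t
  simp [Finset.sum_apply, Pi.single_apply]

/-- The character of `R^I ⊗ R^k = (R^k)^I` given by a map `R^I → Q⁺` and a map `R^k → Q`. -/
def pairing {I : Type u} {Q : ModuleCat.{u} R} {k : ℕ} (ψ : powObj R I ⟶ charObj Q)
    (t : (Fin k → R) →ₗ[R] Q) : (I → Fin k → R) →+ AddCircle (1 : ℚ) where
  toFun v := ∑ j, charVal (ψ.hom (fun i => v i j)) (t (Pi.single j 1))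
  map_zero' := Finset.sum_eq_zero fun j _ => by
    change charVal (ψ.hom (0 : powObj R I)) _ = 0
    rw [map_zero, map_zero, AddMonoidHom.zero_apply]
  map_add' v w := by
    rw [← Finset.sum_add_distrib]
    refine Finset.sum_congr rfl fun j _ => ?_
    change charVal (ψ.hom ((fun i => v i j : powObj R I) + (fun i => w i j : powObj R I))) _ = _
    rw [map_add, map_add, AddMonoidHom.add_apply]

/-- Under R^I ⊗ R^k = (R^k)^I, the family `fun i => b i • w` is the elementary tensor b ⊗ w. -/
theorem pairing_smul {I : Type u} {Q : ModuleCat.{u} R} {k : ℕ} (ψ : powObj R I ⟶ charObj Q)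
    (t : (Fin k → R) →ₗ[R] Q) (b : I → R) (w : Fin k → R) :
    pairing ψ t (fun i => b i • w) = charVal (ψ.hom b) (t w) := by
  have h : ∀ j, charVal (ψ.hom (fun i => (b i • w) j)) (t (Pi.single j 1)) =
      charVal (ψ.hom b) (t (w j • Pi.single j 1)) := fun j => by
    rw [map_smul]
    refine Eq.trans ?_ (charVal_smul (MulOpposite.op (w j)) (ψ.hom b) _)
    rw [← LinearMap.map_smul ψ.hom]
    rfl
  change ∑ j, charVal (ψ.hom (fun i => (b i • w) j)) (t (Pi.single j 1)) = _
  rw [Finset.sum_congr rfl fun j _ => h j, ← map_sum, ← map_sum]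
  congr 2
  ext i
  simp [Finset.sum_apply, Pi.single_apply]

/-- Both sides are additive in `v`, and every `v` is a finite sum of elementary tensors of columns
with basis vectors. -/
theorem pairing_comp {I : Type u} {Q : ModuleCat.{u} R} {k m : ℕ} (ψ : powObj R I ⟶ charObj Q)
    (t : (Fin m → R) →ₗ[R] Q) (g : (Fin k → R) →ₗ[R] (Fin m → R)) (v : I → Fin k → R) :
    pairing ψ (t ∘ₗ g) v = pairing ψ t (fun i => g (v i)) := by
  let G : (I → Fin k → R) →+ (I → Fin m → R) := (g.compLeft I).toAddMonoidHom
  change _ = (pairing ψ t).comp G v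
  rw [eq_sum_columns v, map_sum, map_sum]
  refine Finset.sum_congr rfl fun j _ => ?_
  rw [pairing_smul, LinearMap.comp_apply, ← pairing_smul]
  exact congrArg _ (funext fun i => (map_smul g (v i j) _).symm)

/-- A finitely `2`-presented module `C` satisfies `Tor₁(R^I, C) = 0`, stated with `Ext`. -/
theorem ext_pow_one {C : ModuleCat.{u} R} (hC : FinitelyPresented 2 C) (I : Type u) :
    Subsingleton (Abelian.Ext (powObj R I) (charObj C) 1) := by
  obtain ⟨P, p, hP, hP', hp, hK⟩ := (finitelyPresented_succ_iff 1 C).1 hC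
  obtain ⟨F, q, hF, hF', hq, hL⟩ := (finitelyPresented_succ_iff 0 _).1 hK
  rw [finitelyPresented_zero_iff] at hL
  have := Module.finitePresentation_of_projective R F
  have : Module.FinitePresentation R (LinearMap.ker p) :=
    Module.finitePresentation_of_surjective q hq (Module.Finite.iff_fg.1 hL)
  obtain ⟨k, π, hπ⟩ := Module.Finite.exists_fin' R (LinearMap.ker p)
  obtain ⟨t, l, hl⟩ := Submodule.fg_iff_exists_fin_generating_family.1
    (Module.FinitePresentation.fg_ker π hπ)
  obtain ⟨m, s, g, -, hg, -⟩ := Module.Finite.exists_comp_eq_id_of_projective R P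
  rw [ext_char_one_iff p hp]
  intro φ
  let G : (Fin k → R) →ₗ[R] (Fin m → R) := g ∘ₗ (LinearMap.ker p).subtype ∘ₗ π
  -- The kernel of (R^k)^I → (R^m)^I is (ker π)^I. As ker π is generated by finitely many `l j`, its
  -- elements are finite sums of tensors a_j ⊗ l_j, which the pairing kills because π(l_j) = 0.
  obtain ⟨χ, hχ⟩ := exists_character_extension (G.compLeft I).toAddMonoidHom
    (pairing (Q := ModuleCat.of R (LinearMap.ker p)) φ π) fun v hv => by
      have hv' : ∀ i, v i ∈ Submodule.span R (Set.range l) := fun i => by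
        rw [hl, LinearMap.mem_ker]
        exact Subtype.ext (hg ((congrFun hv i).trans (map_zero g).symm))
      choose a ha using fun i => (Submodule.mem_span_range_iff_exists_fun R).1 (hv' i)
      have hsum : v = ∑ j, fun i => a i j • l j := by
        ext1 i
        rw [Finset.sum_apply]
        exact (ha i).symm
      rw [hsum, map_sum]
      refine Finset.sum_eq_zero fun j _ => ?_
      have hlj : π (l j) = 0 := by
        rw [← LinearMap.mem_ker, ← hl]
        exact Submodule.subset_span ⟨j, rfl⟩
      rw [pairing_smul (Q := ModuleCat.of R (LinearMap.ker p)) φ π (fun i => a i j), hlj,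
        map_zero]
  -- The extension of `φ` sends `a` to the character x ↦ χ(a ⊗ g x) of `P`, with `g` embedding `P`
  -- into R^m.
  refine ⟨ModuleCat.ofHom
    { toFun := fun a => ({
        toFun := fun x => χ fun i => a i • g x
        map_zero' := by
          refine Eq.trans (congrArg χ ?_) (map_zero χ)
          ext1 i
          simp
        map_add' := fun x y => by
          refine Eq.trans (congrArg χ ?_) (map_add χ _ _)
          ext1 i
          simp } : P →+ AddCircle (1 : ℚ))
      map_add' := fun a b => charVal_injective (AddMonoidHom.ext fun x => by
        refine Eq.trans (congrArg χ ?_) (map_add χ _ _)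
        ext1 i
        exact add_smul (a i) (b i) (g x))
      map_smul' := fun r a => charVal_injective (AddMonoidHom.ext fun x => congrArg χ (by
        ext1 i
        change (a i * r.unop) • g x = a i • g (r.unop • x)
        rw [map_smul, mul_smul])) }, fun a x => ?_⟩
  obtain ⟨w, rfl⟩ := hπ x
  rw [← pairing_smul (Q := ModuleCat.of R (LinearMap.ker p)) φ π a w, ← hχ]
  refine congrArg χ (funext fun i => ?_)
  exact (map_smul G (a i) w).symm

/-- A finitely presented module `C` with `Tor₁(R^I, C) = 0` for all `I` is finitely
`2`-presented. -/
theorem finitelyPresented_two_of_ext {C : ModuleCat.{u} R} (hC : FinitelyPresented 1 C)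
    (h : ∀ I : Type u, Subsingleton (Abelian.Ext (powObj R I) (charObj C) 1)) :
    FinitelyPresented 2 C := by
  obtain ⟨P, p, hP, hP', hp, hK⟩ := (finitelyPresented_succ_iff 0 C).1 hC
  rw [finitelyPresented_zero_iff] at hK
  obtain ⟨k, π, hπ⟩ := Module.Finite.exists_fin' R (LinearMap.ker p)
  refine (finitelyPresented_succ_iff 1 C).2 ⟨P, p, hP, hP', hp,
    (finitelyPresented_succ_iff 0 _).2 ⟨ModuleCat.of R (Fin k → R), π, ?_, ?_, hπ, ?_⟩⟩
  · change Module.Finite R (Fin k → R); infer_instance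
  · change Module.Projective R (Fin k → R); infer_instance
  rw [finitelyPresented_zero_iff]
  refine Module.Finite.iff_fg.2 ?_
  -- Take I = L = ker π. The subgroup `S` is the image of R^I ⊗ L in L^I; if it contains the
  -- tautological family, finitely many elements of L generate all of L.
  let I : Type u := LinearMap.ker π
  let S : AddSubgroup (I → Fin k → R) :=
    AddSubgroup.closure {v | ∃ (a : I → R) (l : I), v = fun i => a i • l.1}
  have key : (fun i => i.1 : I → Fin k → R) ∈ S := by
    by_contra hS
    obtain ⟨χ, hχ, hne⟩ := exists_character_of_notMem S hS
    refine hne ?_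
    -- Since χ kills a ⊗ l for l in ker π, the map w ↦ χ(a ⊗ w) descends along π to the kernel of
    -- `p`.
    have hext : ∀ a : I → R, ∃ θ : LinearMap.ker p →+ AddCircle (1 : ℚ),
        ∀ w, θ (π w) = χ fun i => a i • w := fun a =>
      exists_character_extension π.toAddMonoidHom
        { toFun := fun w => χ fun i => a i • w
          map_zero' := by
            refine Eq.trans (congrArg χ ?_) (map_zero χ)
            ext1 i
            simp
          map_add' := fun x y => by
            refine Eq.trans (congrArg χ ?_) (map_add χ _ _)
            ext1 i
            simp } fun w hw => hχ _ (AddSubgroup.subset_closure ⟨a, ⟨w, hw⟩, rfl⟩)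
    choose θ hθ using hext
    let φ : powObj R I ⟶ charObj (ModuleCat.of R (LinearMap.ker p)) := ModuleCat.ofHom
      { toFun := fun a => θ a
        map_add' := fun a b => charVal_injective (C := ModuleCat.of R (LinearMap.ker p))
          (AddMonoidHom.ext fun x => by
          obtain ⟨w, rfl⟩ := hπ x
          change θ (fun i => a i + b i) (π w) = θ a (π w) + θ b (π w)
          rw [hθ, hθ, hθ, ← map_add]
          refine congrArg χ ?_
          ext1 i
          exact add_smul (a i) (b i) w)
        map_smul' := fun r a => charVal_injective (C := ModuleCat.of R (LinearMap.ker p))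
          (AddMonoidHom.ext fun x => by
          obtain ⟨w, rfl⟩ := hπ x
          change θ (fun i => a i * r.unop) (π w) = θ a (r.unop • π w)
          rw [← map_smul, hθ, hθ]
          refine congrArg χ ?_
          ext1 i
          exact mul_smul (a i) r.unop w) }
    obtain ⟨ψ, hψ⟩ := (ext_char_one_iff p hp _).1 (h I) φ
    obtain ⟨m, s, g, -, -, hsg⟩ := Module.Finite.exists_comp_eq_id_of_projective R P
    let ι : (Fin k → R) →ₗ[R] P := (LinearMap.ker p).subtype ∘ₗ π
    -- Once `φ` extends to P⁺, χ depends only on the image of a family in P^I, and there the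
    -- tautological family becomes 0, contradicting `hne`.
    have hpair : ∀ v, χ v = pairing ψ ι v := fun v => by
      rw [eq_sum_columns v, map_sum, map_sum]
      refine Finset.sum_congr rfl fun j _ => ?_
      rw [pairing_smul]
      exact ((hψ (fun i => v i j) (π (Pi.single j 1))).trans (hθ (fun i => v i j) _)).symm
    have hι : ι = s ∘ₗ g ∘ₗ ι := by
      rw [← LinearMap.comp_assoc, hsg, LinearMap.id_comp]
    rw [hpair, hι, pairing_comp]
    refine Eq.trans (congrArg _ ?_) (map_zero (pairing ψ s))
    ext1 i
    change g (π i.1).1 = 0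
    rw [show π i.1 = 0 from i.2]
    exact map_zero g
  -- A member of `S` involves only finitely many generators, so all its coordinates lie in one
  -- finitely generated submodule of ker π.
  have hfg : ∀ v ∈ S, ∃ N : Submodule R (Fin k → R), N.FG ∧ N ≤ LinearMap.ker π ∧
      ∀ i, v i ∈ N := fun v hv => by
    induction hv using AddSubgroup.closure_induction with
    | mem v hv =>
      obtain ⟨a, l, rfl⟩ := hv
      refine ⟨Submodule.span R {l.1}, Submodule.fg_span_singleton _, ?_, fun i => ?_⟩
      · rw [Submodule.span_singleton_le_iff_mem]
        exact l.2
      · exact Submodule.smul_mem _ _ (Submodule.mem_span_singleton_self _)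
    | zero => exact ⟨⊥, Submodule.fg_bot, bot_le, fun i => Submodule.zero_mem _⟩
    | add v w _ _ hv hw =>
      obtain ⟨N, h1, h2, h3⟩ := hv
      obtain ⟨N', h1', h2', h3'⟩ := hw
      exact ⟨N ⊔ N', h1.sup h1', sup_le h2 h2', fun i => Submodule.add_mem _
        ((le_sup_left : N ≤ N ⊔ N') (h3 i)) ((le_sup_right : N' ≤ N ⊔ N') (h3' i))⟩
    | neg v _ hv =>
      obtain ⟨N, h1, h2, h3⟩ := hv
      exact ⟨N, h1, h2, fun i => Submodule.neg_mem _ (h3 i)⟩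
  obtain ⟨N, h1, h2, h3⟩ := hfg _ key
  rwa [le_antisymm h2 fun x hx => h3 ⟨x, hx⟩] at h1

/-- Passing to the kernel of a projective cover lowers both the presentation length and the Ext
degree by one, down to `ext_pow_one`. -/
theorem ext_pow_of_finitelyPresented (m : ℕ) {C : ModuleCat.{u} R}
    (hC : FinitelyPresented (m + 1) C) (I : Type u) (i : ℕ) (hi : i + 1 ≤ m) :
    Subsingleton (Abelian.Ext (powObj R I) (charObj C) (i + 1)) := by
  induction i generalizing m C with
  | zero => exact ext_pow_one (hC.of_le (by lia)) I
  | succ i ih =>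
    obtain ⟨m, rfl⟩ : ∃ m', m = m' + 1 := ⟨m - 1, by lia⟩
    obtain ⟨P, p, hP, hP', hp, hK⟩ := (finitelyPresented_succ_iff _ C).1 hC
    exact (ext_char_shift p hp _ i).2 (ih m hK (by lia))

/-- The same descent to kernels, ending at `finitelyPresented_two_of_ext`. -/
theorem finitelyPresented_of_ext_pow (m : ℕ) {C : ModuleCat.{u} R}
    (hC : FinitelyPresented (m + 1) C)
    (h : ∀ I : Type u, Subsingleton (Abelian.Ext (powObj R I) (charObj C) (m + 1))) :
    FinitelyPresented (m + 2) C := by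
  induction m generalizing C with
  | zero => exact finitelyPresented_two_of_ext hC h
  | succ m ih =>
    obtain ⟨P, p, hP, hP', hp, hK⟩ := (finitelyPresented_succ_iff _ C).1 hC
    exact (finitelyPresented_succ_iff _ C).2 ⟨P, p, hP, hP', hp,
      ih hK fun I => (ext_char_shift p hp _ m).1 (h I)⟩

end Presentations

/-! ### Flat and cotorsion classes. -/

section Classes

variable {R : Type u} [Ring R]

/-- The projective dimension of a kernel of a map from a projective module does not exceed
`d ≥ 1` if the one of the quotient does not. -/
theorem projectiveDimension_ker_le {P C : ModuleCat.{u} R} [Module.Projective R P]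
    (p : P →ₗ[R] C) (hp : Function.Surjective p) {d : ℕ∞} (hd : 1 ≤ d)
    (hC : projectiveDimension C ≤ (d : WithBot ℕ∞)) :
    projectiveDimension (ModuleCat.of R (LinearMap.ker p)) ≤ (d : WithBot ℕ∞) := by
  induction d with
  | top => exact le_top
  | coe k =>
    -- For finite d = k' + 1 the kernel even has dimension at most k'; the weaker bound d is what
    -- keeps it in the same class.
    obtain ⟨k, rfl⟩ : ∃ k', k = k' + 1 := ⟨k - 1, by
      have : 1 ≤ k := by exact_mod_cast hd
      lia⟩
    have hS := LinearMap.shortExact_shortComplexKer hp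
    have h2 : Projective p.shortComplexKer.X₂ :=
      (IsProjective.iff_projective (R := R) P).1 inferInstance
    have h3 : HasProjectiveDimensionLT p.shortComplexKer.X₃ (k + 2) :=
      (projectiveDimension_le_iff C (k + 1)).1 hC
    have h1 : HasProjectiveDimensionLT p.shortComplexKer.X₁ (k + 1) :=
      (hS.hasProjectiveDimensionLT_X₃_iff k h2).1 h3
    exact (projectiveDimension_le_iff _ (k + 1)).2
      (hasProjectiveDimensionLT_of_ge (ModuleCat.of R (LinearMap.ker p)) (k + 1) (k + 2) (by lia))

theorem fpFlat_iff {n : ℕ} {d : ℕ∞} {M : ModuleCat.{u} Rᵐᵒᵖ} :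
    FPFlat n d M ↔ ∀ C : ModuleCat.{u} R, FPLe n d C →
      Subsingleton (Abelian.Ext M (charObj C) 1) :=
  forall₂_congr fun C _ => isZero_tor_iff 0 M C

/-- Over an `(n, d)`-coherent ring, the higher `Tor` of `FP_n^{≤ d}`-flat modules vanish. -/
theorem IsLeftCoherent.ext_eq_zero {n : ℕ} {d : ℕ∞} (hd : 1 ≤ d) (hR : IsLeftCoherent R n d)
    {M : ModuleCat.{u} Rᵐᵒᵖ} (hM : FPFlat n d M) (j : ℕ) {C : ModuleCat.{u} R}
    (hC : FPLe n d C) : Subsingleton (Abelian.Ext M (charObj C) (j + 1)) := by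
  induction j generalizing C with
  | zero => exact fpFlat_iff.1 hM C hC
  | succ j ih =>
    obtain ⟨P, p, hP, hP', hp, hK⟩ := (finitelyPresented_succ_iff n C).1 (hR C hC)
    exact (ext_char_shift p hp M j).2 (ih ⟨hK, projectiveDimension_ker_le p hp hd hC.2⟩)

/-- Syzygies of `R^I` are `FP_{m + 2}^{≤ d}`-flat. -/
theorem fpFlat_syzygy_pow (m : ℕ) (d : ℕ∞) (I : Type u) :
    FPFlat (m + 2) d (syzygy (powObj R I) m) :=
  fpFlat_iff.2 fun C hC => (ext_syzygy _ _ m 0).2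
    (ext_pow_of_finitelyPresented (m + 1) hC.1 I (0 + m) (by lia))

/-- Test on M = Ω^m R^I: Tor_2(M, C) = 0 amounts to Tor_{m+2}(R^I, C) = 0. -/
theorem isLeftCoherent_of_tor_two {m : ℕ} {d : ℕ∞}
    (h : ∀ (C : ModuleCat.{u} R) (M : ModuleCat.{u} Rᵐᵒᵖ), FPLe (m + 2) d C →
      FPFlat (m + 2) d M → Limits.IsZero (Tor 2 M C)) : IsLeftCoherent R (m + 2) d := by
  intro C hC
  refine finitelyPresented_of_ext_pow (m + 1) hC.1 fun I => ?_
  have := (ext_syzygy _ _ m 1).1 ((isZero_tor_iff 1 _ C).1 (h C _ hC (fpFlat_syzygy_pow m d I)))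
  rwa [show 1 + m + 1 = m + 1 + 1 by lia] at this

/-- Test on Ω^{m+1} R^I, which is FP_{m+3}-flat; its FP_{m+2}-flatness again says Tor_{m+2}(R^I, C)
= 0. -/
theorem isLeftCoherent_of_fpFlat {m : ℕ} {d : ℕ∞}
    (h : ∀ M : ModuleCat.{u} Rᵐᵒᵖ, FPFlat (m + 3) d M → FPFlat (m + 2) d M) :
    IsLeftCoherent R (m + 2) d := by
  intro C hC
  refine finitelyPresented_of_ext_pow (m + 1) hC.1 fun I => ?_
  have := (ext_syzygy _ _ (m + 1) 0).1 (fpFlat_iff.1 (h _ (fpFlat_syzygy_pow (m + 1) d I)) C hC)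
  rwa [show 0 + (m + 1) + 1 = m + 1 + 1 by lia] at this

theorem fpCot_charObj {n : ℕ} {d : ℕ∞} {C : ModuleCat.{u} R} (hC : FPLe n d C) :
    FPCot n d (charObj C) :=
  fun _ hF => fpFlat_iff.1 hF C hC

/-- The right class is an orthogonal by definition; the cotorsion modules C⁺ alone already force
flatness on the left. -/
theorem isCotorsionPair_fpFlat (n : ℕ) (d : ℕ∞) :
    IsCotorsionPair (FPFlat n d : ObjectProperty (ModuleCat.{u} Rᵐᵒᵖ)) (FPCot n d) where
  right_iff _ := Iff.rfl
  left_iff _ := ⟨fun hX _ hY => hY _ hX, fun h =>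
    fpFlat_iff.2 fun _ hC => h _ (fpCot_charObj hC)⟩

/-- Tor_1 of the next syzygy vanishes exactly when Tor_2 of the present one does. -/
theorem fpFlat_syzygy {n : ℕ} {d : ℕ∞}
    (h : ∀ (C : ModuleCat.{u} R) (M : ModuleCat.{u} Rᵐᵒᵖ), FPLe n d C →
      FPFlat n d M → Limits.IsZero (Tor 2 M C)) {M : ModuleCat.{u} Rᵐᵒᵖ} (hM : FPFlat n d M)
    (k : ℕ) : FPFlat n d (syzygy M k) := by
  induction k with
  | zero => exact hM
  | succ k ih =>
    exact fpFlat_iff.2 fun C hC =>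
      (ext_syzygy (syzygy M k) _ 1 0).2 ((isZero_tor_iff 1 _ C).1 (h C _ hC ih))

end Classes

end NDCoh

end

/-! ### The equivalences. -/

theorem mainTheorem3 {R : Type u} [Ring R] (n : ℕ) (hn : 2 ≤ n) (d : ℕ∞) (hd : 1 ≤ d) :
    List.TFAE [
      NDCoh.IsLeftCoherent R n d,
      ∀ (j : ℕ) (C : ModuleCat.{u} R) (M : ModuleCat.{u} Rᵐᵒᵖ),
        NDCoh.FPLe n d C → NDCoh.FPFlat n d M → Limits.IsZero (NDCoh.Tor (j + 1) M C),
      ∀ (C : ModuleCat.{u} R) (M : ModuleCat.{u} Rᵐᵒᵖ),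
        NDCoh.FPLe n d C → NDCoh.FPFlat n d M → Limits.IsZero (NDCoh.Tor 2 M C),
      ∀ M : ModuleCat.{u} Rᵐᵒᵖ, NDCoh.FPFlat (n + 1) d M → NDCoh.FPFlat n d M,
      ∀ M : ModuleCat.{u} Rᵐᵒᵖ, NDCoh.FPCot n d M → NDCoh.FPCot (n + 1) d M,
      NDCoh.IsHereditaryCotorsionPair
        (NDCoh.FPFlat n d : ObjectProperty (ModuleCat.{u} Rᵐᵒᵖ))
        (NDCoh.FPCot n d : ObjectProperty (ModuleCat.{u} Rᵐᵒᵖ))] := by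
  -- Here m = n - 2 is the order of the syzygy of R^I that is FP_n-flat over every ring.
  obtain ⟨m, rfl⟩ : ∃ m, n = m + 2 := ⟨n - 2, by lia⟩
  tfae_have 1 → 2 := fun hR j C M hC hM =>
    (NDCoh.isZero_tor_iff j M C).2 (hR.ext_eq_zero hd hM j hC)
  tfae_have 2 → 3 := fun h C M hC hM => h 1 C M hC hM
  tfae_have 3 → 1 := NDCoh.isLeftCoherent_of_tor_two
  tfae_have 1 → 4 := fun hR M hM C hC => hM C ⟨hR C hC, hC.2⟩
  tfae_have 4 → 1 := NDCoh.isLeftCoherent_of_fpFlat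
  tfae_have 4 → 5 := fun h M hM F hF => hM F (h F hF)
  tfae_have 5 → 4 := fun h M hM => NDCoh.fpFlat_iff.2 fun C hC =>
    h _ (NDCoh.fpCot_charObj hC) M hM
  tfae_have 3 → 6 := fun h =>
    { NDCoh.isCotorsionPair_fpFlat (m + 2) d with
      ext_vanish := fun X Y hX hY i hi => by
        obtain ⟨i, rfl⟩ : ∃ i', i = i' + 1 := ⟨i - 1, by lia⟩
        -- Ext^{i+1}(X, Y) is traded for Ext¹ of the i-th syzygy of X, which is still flat.
        have := (NDCoh.ext_syzygy X Y i 0).1 (hY _ (NDCoh.fpFlat_syzygy h hX i))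
        rwa [Nat.zero_add] at this }
  tfae_have 6 → 3 := fun h C M hC hM => (NDCoh.isZero_tor_iff 1 M C).2
    (h.ext_vanish M _ hM (NDCoh.fpCot_charObj hC) 2 (by lia))
  tfae_finish
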